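/- Let $P(x,y),Q(x,y)\in\mathbb{C}[x,y]$ be polynomials without non-constant common factors, with $P\not\equiv 0$, and let $\mathcal{X}=P\,\partial_x+Q\,\partial_y$. A Puiseux series near $x=\infty$ is a formal series $y(x)=\sum_{l=0}^{+\infty}c_l\,x^{(l_0-l)/n_0}$ with $c_l\in\mathbb{C}$, $l_0\in\mathbb{Z}$, $n_0\in\mathbb{N}$, $n_0\ge 1$. An invariant algebraic curve of $\mathcal{X}$ is a polynomial $F\in\mathbb{C}[x,y]\setminus\mathbb{C}$ such that $PF_x+QF_y=\lambda F$ for some $\lambda\in\mathbb{C}[x,y]$, where $F$ and $cF$ with $c\in\mathbb{C}\setminus\{0\}$ are regarded as the same curve. A rational first integral of $\mathcal{X}$ is a rational function $R\in\mathbb{C}(x,y)\setminus\mathbb{C}$ with $\mathcal{X}R=0$. Suppose that only finitely many Puiseux series near $x=\infty$ satisfy the equation $P(x,y)\,y_x-Q(x,y)=0$. Then $\mathcal{X}$ has only finitely many (possibly no) irreducible invariant algebraic curves and it has no rational first integral. Moreover, the number of distinct irreducible invariant algebraic curves $F$ with $F_y\not\equiv 0$ does not exceed the number of distinct Puiseux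 series near $x=\infty$ that satisfy $P(x,y)\,y_x-Q(x,y)=0$. -/

import Mathlib

noncomputable section

namespace PlanarVectorField

/-- The ring `ℂ[x, y]`; the variable `x` has index `0`, the variable `y` has index `1`. -/
abbrev Poly2 : Type := MvPolynomial (Fin 2) ℂ

/-- The field `ℂ(x, y)`. -/
abbrev Rat2 : Type := FractionRing Poly2

/-- The polynomial vector field `P ∂/∂x + Q ∂/∂y`, acting on polynomials. -/
def vectorField (P Q : Poly2) : Derivation ℂ Poly2 Poly2 :=
  P • MvPolynomial.pderiv 0 + Q • MvPolynomial.pderiv 1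

/-- `F` is an invariant algebraic curve (Darboux polynomial) of `P ∂/∂x + Q ∂/∂y`:
a non-constant polynomial with `P F_x + Q F_y = λ F` for some polynomial `λ`. -/
def IsInvariantCurve (P Q F : Poly2) : Prop :=
  F ∉ Set.range (MvPolynomial.C : ℂ → Poly2) ∧ ∃ cof : Poly2, vectorField P Q F = cof * F

/-- The irreducible invariant algebraic curves. Two polynomials give the same curve when they
differ by a non-zero constant factor, that is, by a unit of `ℂ[x, y]`. -/
def irreducibleInvariantCurves (P Q : Poly2) : Set (Associates Poly2) :=
  Associates.mk '' {F | Irreducible F ∧ IsInvariantCurve P Q F}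

/-- The irreducible invariant algebraic curves `F` with `F_y ≢ 0`. -/
def irreducibleInvariantCurvesInY (P Q : Poly2) : Set (Associates Poly2) :=
  Associates.mk ''
    {F | Irreducible F ∧ IsInvariantCurve P Q F ∧ MvPolynomial.pderiv 1 F ≠ 0}

/-- The vector field `P ∂/∂x + Q ∂/∂y` acting on rational functions, by the quotient rule. -/
def vectorFieldRat (P Q : Poly2) (R : Rat2) : Rat2 :=
  let A : Poly2 := IsFractionRing.num Poly2 R
  let B : Poly2 := IsFractionRing.den Poly2 R
  algebraMap Poly2 Rat2 (vectorField P Q A * B - A * vectorField P Q B) /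
    algebraMap Poly2 Rat2 B ^ 2

/-- The quotient rule gives equal values on equal fractions. -/
theorem quotientRule_congr {A K : Type*} [CommRing A] [Field K] [Algebra A K]
    [FaithfulSMul A K] (X : Derivation ℤ A A) (a b a' b' : A) (hb : b ≠ 0) (hb' : b' ≠ 0)
    (e : algebraMap A K a / algebraMap A K b = algebraMap A K a' / algebraMap A K b') :
    algebraMap A K (X a * b - a * X b) / algebraMap A K b ^ 2 =
      algebraMap A K (X a' * b' - a' * X b') / algebraMap A K b' ^ 2 := by
  have inj : Function.Injective (algebraMap A K) := FaithfulSMul.algebraMap_injective A K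
  have hbK : algebraMap A K b ≠ 0 := fun h => hb (inj (by simpa using h))
  have hbK' : algebraMap A K b' ≠ 0 := fun h => hb' (inj (by simpa using h))
  have e1 : a * b' = a' * b := by
    rw [div_eq_div_iff hbK hbK'] at e
    exact inj (by simpa using e)
  have e2 := congrArg X e1
  simp only [Derivation.leibniz, smul_eq_mul] at e2
  rw [div_eq_div_iff (pow_ne_zero 2 hbK) (pow_ne_zero 2 hbK')]
  simp only [← map_pow, ← map_mul]
  congr 1
  linear_combination (b * b') * e2 - (b * X b' + b' * X b) * e1

/-- The value of the vector field on a quotient does not depend on the fraction chosen. -/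
theorem vectorFieldRat_div (P Q A B : Poly2) (hB : B ≠ 0) :
    vectorFieldRat P Q (algebraMap Poly2 Rat2 A / algebraMap Poly2 Rat2 B) =
      algebraMap Poly2 Rat2 (vectorField P Q A * B - A * vectorField P Q B) /
        algebraMap Poly2 Rat2 B ^ 2 :=
  quotientRule_congr (K := Rat2) ((vectorField P Q).restrictScalars ℤ) _ _ A B
    (nonZeroDivisors.ne_zero (IsFractionRing.den Poly2 _).2) hB
    (by rw [← IsFractionRing.mk'_eq_div, IsFractionRing.mk'_num_den])

/-- `R` is a rational first integral: a non-constant rational function killed by the field. -/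
def IsRationalFirstIntegral (P Q : Poly2) (R : Rat2) : Prop :=
  R ∉ Set.range (fun c : ℂ => algebraMap Poly2 Rat2 (MvPolynomial.C c)) ∧
    vectorFieldRat P Q R = 0

/-- The field in which Puiseux series near `x = ∞` live: Hahn series with rational exponents.
The coefficient at `q` is the coefficient of `x ^ (-q)`. -/
abbrev SeriesAtInfinity : Type := HahnSeries ℚ ℂ

/-- The series `x`. -/
def seriesX : SeriesAtInfinity := HahnSeries.single (-1) 1

/-- Puiseux series near `x = ∞`: series `∑ l ≥ 0, c_l x ^ ((l₀ - l) / n₀)` with `l₀ ∈ ℤ` and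
`n₀` a positive integer. -/
def IsPuiseux (y : SeriesAtInfinity) : Prop :=
  ∃ (l₀ : ℤ) (n₀ : ℕ), 0 < n₀ ∧
    ∀ q ∈ y.support, ∃ l : ℕ, -q = ((l₀ : ℚ) - (l : ℚ)) / (n₀ : ℚ)

/-- Termwise differentiation with respect to `x`. The term `c x ^ (-q)` is sent to
`-q c x ^ (-(q + 1))`, so the coefficient of `x ^ (-r)` in the derivative is
`(1 - r)` times the coefficient of `x ^ (-(r - 1))`. -/
def seriesDeriv (y : SeriesAtInfinity) : SeriesAtInfinity where
  coeff r := (1 - (r : ℂ)) * y.coeff (r - 1)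
  isPWO_support' := by
    refine (y.isPWO_support.image_of_monotone
      (f := fun q : ℚ => q + 1) (fun a b h => by simpa using h)).mono ?_
    intro r hr
    exact ⟨r - 1, right_ne_zero_of_mul hr, by ring⟩

/-- Substitution of a series `y = y(x)` into a polynomial `F(x, y)`. -/
def substSeries (F : Poly2) (y : SeriesAtInfinity) : SeriesAtInfinity :=
  MvPolynomial.eval₂ HahnSeries.C ![seriesX, y] F

/-- The Puiseux series near `x = ∞` that satisfy `P(x, y) y_x - Q(x, y) = 0`. -/
def puiseuxSolutions (P Q : Poly2) : Set SeriesAtInfinity :=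
  {y | IsPuiseux y ∧ substSeries P y * seriesDeriv y - substSeries Q y = 0}

end PlanarVectorField

end

/-! An irreducible `F` with `F_y ≠ 0` has a Puiseux root `y(x)` near infinity
(`exists_isPuiseux_substSeries_eq_zero`). Differentiating `F(x, y(x)) = 0` and combining with
invariance gives `F_y · (P y_x - Q) = 0` along `y`. Here `F_y` does not vanish, because an
irreducible polynomial divides everything that vanishes on one of its Puiseux roots
(`dvd_of_substSeries_eq_zero`), and `F_y` has smaller degree in `y`. So `y` solves the equation
(`mem_puiseuxSolutions`). The same divisibility shows that curves sharing a root are associates, so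
choosing one root per curve is injective; this is the bound.

Irreducible curves with `F_y = 0` are prime factors of `P ≠ 0`, so there are finitely many
(`dvd_of_pderiv_one_eq_zero`). A rational first integral `A / B` would produce infinitely many
curves, from the factors of the pencil `A - cB` (`infinite_irreducibleInvariantCurves`).

The existence of roots is the Newton–Puiseux theorem, proved for any henselian valuation ring with
divisible value group and algebraically closed residue field of characteristic zero, then applied to
the union of the rings `ℂ⟦x^(-1/N)⟧`. -/

open Polynomial IsLocalRing

/-! ### Roots of polynomials over henselian valuation rings -/

/-- Hensel's lemma for polynomials that need not be monic, at the approximate root `0`. -/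
theorem HenselianLocalRing.exists_isRoot_mem_maximalIdeal {O : Type*} [CommRing O]
    [HenselianLocalRing O] (f : O[X]) (h0 : f.coeff 0 ∈ maximalIdeal O)
    (h1 : IsUnit (f.coeff 1)) : ∃ a ∈ maximalIdeal O, f.IsRoot a := by
  obtain ⟨u, hu⟩ := h1.exists_left_inv
  set c := f.coeff 0
  -- Write `f(y) = c + f₁ y + y² q(y)` with `u = f₁⁻¹`. Putting `y = c u / z`, dividing by `c` and
  -- clearing denominators turns `f(y) = 0` into `h(z) = 0` with `h` monic. Modulo the maximal ideal
  -- `h` is `z^(N+1) (z + 1)`, with simple root `-1`.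
  set r : O[X] := f.divX.divX.comp (C (c * u) * X) with hr
  set N := r.natDegree
  set h : O[X] := X ^ (N + 2) + (X ^ (N + 1) + C (c * u ^ 2) * reflect N r) with hh
  have hq (y : O) : f.eval y = c + f.coeff 1 * y + y ^ 2 * f.divX.divX.eval y := by
    conv_lhs => rw [← f.divX_mul_X_add, ← f.divX.divX_mul_X_add]
    simp only [eval_add, eval_mul, eval_X, eval_C, coeff_divX]
    ring
  have hmon : h.Monic := by
    refine monic_X_pow_add ?_
    have hd : (X ^ (N + 1) + C (c * u ^ 2) * reflect N r).natDegree ≤ N + 1 := by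
      refine natDegree_add_le_of_degree_le (natDegree_X_pow_le _) ?_
      refine (natDegree_C_mul_le _ _).trans (natDegree_reflect_le.trans ?_)
      simp [N]
    exact (degree_le_of_natDegree_le hd).trans_lt (by exact_mod_cast Nat.lt_succ_self _)
  have hroot : h.eval (-1) ∈ maximalIdeal O := by
    have : h.eval (-1) = c * (u ^ 2 * (reflect N r).eval (-1)) := by
      simp only [hh, eval_add, eval_mul, eval_pow, eval_X, eval_C]
      ring
    rw [this]
    exact Ideal.mul_mem_right _ _ h0
  have hder : IsUnit (h.derivative.eval (-1)) := by
    have : h.derivative.eval (-1) =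
        c * (u ^ 2 * (reflect N r).derivative.eval (-1)) + (-1) ^ (N + 1) := by
      simp only [hh, derivative_add, derivative_mul, derivative_X_pow, derivative_C, eval_add,
        eval_mul, eval_pow, eval_X, eval_C, zero_mul, zero_add]
      simp
      ring
    rw [this]
    by_contra hn
    have hm := (Ideal.add_mem_iff_right _ (Ideal.mul_mem_right _ _ h0)).1
      ((mem_maximalIdeal _).2 hn)
    exact (mem_maximalIdeal _).1 hm ((isUnit_one.neg).pow _)
  obtain ⟨z, hz, hz1⟩ := HenselianLocalRing.is_henselian h hmon (-1) hroot hder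
  have hzu : IsUnit z := by
    by_contra hn
    have hm := (Ideal.sub_mem _ ((mem_maximalIdeal _).2 hn) hz1)
    simp only [sub_sub_cancel] at hm
    exact (mem_maximalIdeal _).1 hm isUnit_one.neg
  obtain ⟨w, rfl⟩ := hzu
  refine ⟨c * u * (w⁻¹ : Oˣ), by rw [mul_assoc]; exact Ideal.mul_mem_right _ _ h0, ?_⟩
  let _ : Invertible ((w⁻¹ : Oˣ) : O) := ⟨w, by simp, by simp⟩
  have hrefl := eval₂_reflect_mul_pow (RingHom.id O) ((w⁻¹ : Oˣ) : O) N r le_rfl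
  simp only [eval₂_id] at hrefl
  have hinv : ⅟((w⁻¹ : Oˣ) : O) = w := rfl
  rw [hinv, hr, eval_comp] at hrefl
  simp only [eval_mul, eval_C, eval_X] at hrefl
  rw [IsRoot, hq, ← hrefl, ← hr]
  have hz' : (w : O) ^ (N + 2) + (w ^ (N + 1) + c * u ^ 2 * (reflect N r).eval (w : O)) = 0 := by
    simpa [hh] using hz
  have hw : (w : O) * (w⁻¹ : Oˣ) = 1 := by simp
  generalize ((w⁻¹ : Oˣ) : O) = v at hw ⊢
  generalize (w : O) = z at *
  generalize eval z (reflect N r) = E at *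
  have e1 : z ^ N * v ^ N = 1 := by rw [← mul_pow, hw, one_pow]
  have e2 := congrArg (fun t => c * v ^ (N + 2) * t) hz'
  simp only [mul_zero] at e2
  have e3 : c * (v ^ (N + 2)) * (z ^ (N + 2)) = c := by
    rw [mul_assoc, mul_comm (v ^ _), ← mul_pow, hw, one_pow, mul_one]
  have e4 : c * (v ^ (N + 2)) * (z ^ (N + 1)) = c * v := by
    rw [pow_succ v (N + 1), mul_assoc, mul_right_comm, mul_comm (v ^ _), ← mul_pow, hw, one_pow,
      one_mul]
  linear_combination e2 - e3 - e4 + c * v * hu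

theorem ValuationRing.exists_dvd_forall_mem {O ι : Type*} [CommRing O] [IsDomain O]
    [ValuationRing O] (b : ι → O) (s : Finset ι) (hs : s.Nonempty) :
    ∃ i ∈ s, ∀ j ∈ s, b i ∣ b j := by
  classical
  induction hs using Finset.Nonempty.cons_induction with
  | singleton a => exact ⟨a, by simp⟩
  | cons a s ha hs ih =>
    obtain ⟨i, hi, h⟩ := ih
    rcases ValuationRing.dvd_total (b a) (b i) with hd | hd
    · exact ⟨a, by simp, by simpa using fun j hj => hd.trans (h j hj)⟩
    · exact ⟨i, by simp [hi], by simpa [hd] using h⟩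

/-- Choice of the slope of the Newton polygon at a root of multiplicity `m`. -/
theorem ValuationRing.exists_pow_mul_of_associated_pow {O : Type*} [CommRing O] [IsDomain O]
    [ValuationRing O] (hdiv : ∀ (a : O) (n : ℕ), 0 < n → ∃ b : O, Associated (b ^ n) a)
    (m : ℕ) (a : ℕ → O) {i₀ : ℕ} (hi₀ : i₀ < m) (ha : a i₀ ≠ 0) :
    ∃ (b : O) (c : ℕ → O), b ≠ 0 ∧ (∀ i < m, a i = b ^ (m - i) * c i) ∧
      ∃ i < m, IsUnit (c i) := by
  classical
  have hb (i : ℕ) : ∃ b : O, i < m → Associated (b ^ (m - i)) (a i) := by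
    by_cases hi : i < m
    · obtain ⟨b, hb⟩ := hdiv (a i) (m - i) (by omega)
      exact ⟨b, fun _ => hb⟩
    · exact ⟨0, fun h => absurd h hi⟩
  choose b hb using hb
  -- `b i` has valuation `v(a i) / (m - i)`; the least of these is the slope of the Newton polygon.
  obtain ⟨k, hk, hmin⟩ := ValuationRing.exists_dvd_forall_mem b (Finset.range m)
    ⟨i₀, Finset.mem_range.2 hi₀⟩
  rw [Finset.mem_range] at hk
  have hbk : b k ≠ 0 := by
    intro h0
    have h1 := hmin i₀ (Finset.mem_range.2 hi₀)
    rw [h0, zero_dvd_iff] at h1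
    have h2 := hb i₀ hi₀
    rw [h1, zero_pow (by omega)] at h2
    exact ha ((Associated.comm.1 h2).eq_zero_iff.2 rfl)
  have hc (i : ℕ) : ∃ c : O, (i < m → a i = b k ^ (m - i) * c) ∧ (i = k → IsUnit c) := by
    by_cases hik : i = k
    · subst hik
      obtain ⟨u, hu⟩ := hb i hk
      exact ⟨u, fun _ => hu.symm, fun _ => u.isUnit⟩
    · by_cases hi : i < m
      · obtain ⟨c, hc⟩ := (pow_dvd_pow_of_dvd (hmin i (Finset.mem_range.2 hi)) (m - i)).trans
          (hb i hi).dvd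
        exact ⟨c, fun _ => hc, fun h => absurd h hik⟩
      · exact ⟨0, fun h => absurd h hi, fun h => absurd h hik⟩
  choose c hc using hc
  exact ⟨b k, c, hbk, fun i hi => (hc i).1 hi, k, hk, (hc k).2 rfl⟩

/-- A polynomial of degree `m` over a field of characteristic zero, with vanishing coefficient of
degree `m - 1` and some other non-vanishing lower coefficient, is not an `m`-th power of a linear
polynomial up to a constant. -/
theorem Polynomial.exists_taylor_coeff_ne_zero {k : Type*} [Field k] [CharZero k] (g : k[X]) {m : ℕ}
    (hm : 0 < m) (hdeg : g.natDegree = m) (h1 : g.coeff (m - 1) = 0)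
    (h2 : ∃ i < m, g.coeff i ≠ 0) (α : k) :
    ∃ i < m, (taylor α g).coeff i ≠ 0 := by
  by_contra! hcon
  have hT : taylor α g = C g.leadingCoeff * X ^ m := by
    ext i
    rw [coeff_C_mul_X_pow]
    rcases lt_trichotomy i m with hi | rfl | hi
    · rw [hcon i hi, if_neg hi.ne]
    · rw [if_pos rfl, ← hdeg, coeff_taylor_natDegree]
    · rw [if_neg hi.ne', coeff_eq_zero_of_natDegree_lt (by rwa [natDegree_taylor, hdeg])]
  have hlc : g.leadingCoeff ≠ 0 := by
    obtain ⟨i, _, hi⟩ := h2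
    rw [leadingCoeff_ne_zero]
    rintro rfl
    simp at hi
  have hg : g = C g.leadingCoeff * (X + C (-α)) ^ m := by
    conv_lhs => rw [← taylor_zero g, ← neg_add_cancel α, ← taylor_taylor, hT]
    simp [taylor_apply]
  -- Now `g` is a constant times `(X - α)^m`, so its coefficient of degree `m - 1` is `-m α` times
  -- the leading one; characteristic zero forces `α = 0`.
  have hα : α = 0 := by
    rw [hg, coeff_C_mul, coeff_X_add_C_pow] at h1
    have hc : m.choose (m - 1) = m := by
      rw [Nat.choose_symm (by omega : 1 ≤ m), Nat.choose_one_right]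
    rw [hc, show m - (m - 1) = 1 by omega] at h1
    simpa [hlc, hm.ne'] using h1
  obtain ⟨i, hi, hne⟩ := h2
  apply hne
  rw [hg, hα]
  simp [coeff_X_pow, hi.ne]

/-- The Newton polygon step: a root exists as soon as `0` is a root of the reduction. -/
theorem HenselianLocalRing.exists_isRoot_of_multiplicity {O : Type*} [CommRing O] [IsDomain O]
    [ValuationRing O] [HenselianLocalRing O] [IsAlgClosed (ResidueField O)]
    [CharZero (ResidueField O)]
    (hdiv : ∀ (a : O) (n : ℕ), 0 < n → ∃ b : O, Associated (b ^ n) a) (m : ℕ) (hm : 0 < m)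
    (f : O[X]) (h0 : ∀ i < m, f.coeff i ∈ maximalIdeal O) (h1 : IsUnit (f.coeff m)) :
    ∃ a : O, f.IsRoot a := by
  induction m using Nat.strong_induction_on generalizing f with
  | _ m ih =>
  -- The case of vanishing coefficient of degree `m - 1`, to which a Tschirnhaus shift reduces the
  -- general one.
  have key : ∀ f : O[X], (∀ i < m, f.coeff i ∈ maximalIdeal O) → IsUnit (f.coeff m) →
      f.coeff (m - 1) = 0 → ∃ a : O, f.IsRoot a := by
    clear h0 h1 f
    intro f h0 h1 hm1
    by_cases ha0 : f.coeff 0 = 0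
    · exact ⟨0, by rw [IsRoot, ← coeff_zero_eq_eval_zero, ha0]⟩
    obtain ⟨b, c, hb, hc, i₁, hi₁, hci⟩ :=
      ValuationRing.exists_pow_mul_of_associated_pow hdiv m f.coeff hm ha0
    have hbm : b ∈ maximalIdeal O := by
      rw [mem_maximalIdeal]
      intro hu
      refine (mem_maximalIdeal _).1 (h0 i₁ hi₁) ?_
      rw [hc i₁ hi₁]
      exact (hu.pow _).mul hci
    have hmN : m ≤ f.natDegree := le_natDegree_of_ne_zero h1.ne_zero
    -- These are the coefficients of `b^(-m) f(b X)`.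
    let d : ℕ → O := fun i => if i < m then c i else f.coeff i * b ^ (i - m)
    let g : O[X] := ∑ i ∈ Finset.range (f.natDegree + 1), monomial i (d i)
    have hgc (i : ℕ) : g.coeff i = d i := by
      simp only [g, finsetSum_coeff, coeff_monomial]
      rw [Finset.sum_ite_eq']
      split_ifs with h
      · rfl
      · have hi : f.natDegree < i := by simpa using h
        simp [d, not_lt.2 (hmN.trans hi.le), coeff_eq_zero_of_natDegree_lt hi]
    have hge (z : O) : f.eval (b * z) = b ^ m * g.eval z := by
      rw [eval_eq_sum_range]
      simp only [g, eval_finsetSum, eval_monomial, Finset.mul_sum]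
      refine Finset.sum_congr rfl fun i _ => ?_
      simp only [d]
      split_ifs with hi
      · rw [hc i hi, mul_pow]
        have : b ^ m = b ^ (m - i) * b ^ i := by rw [← pow_add]; congr 1; omega
        rw [this]; ring
      · have : b ^ i = b ^ m * b ^ (i - m) := by rw [← pow_add]; congr 1; omega
        rw [mul_pow, this]; ring
    suffices ∃ z, g.IsRoot z by
      obtain ⟨z, hz⟩ := this
      exact ⟨b * z, by rw [IsRoot, hge, hz.eq_zero, mul_zero]⟩
    -- Since `b` lies in the maximal ideal, the terms above degree `m` die. The reduction has degree
    -- `m` and is not a constant times an `m`-th power of a linear polynomial, so each root has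
    -- multiplicity below `m` and the induction applies after a shift.
    set G := g.map (residue O) with hG
    have hGm : G.coeff m ≠ 0 := by
      simpa [hG, hgc, d] using h1
    have hGdeg : G.natDegree = m := by
      refine le_antisymm ?_ (le_natDegree_of_ne_zero hGm)
      rw [natDegree_le_iff_coeff_eq_zero]
      intro i hi
      rw [hG, coeff_map, hgc, residue_eq_zero_iff]
      simp only [d, if_neg (not_lt.2 hi.le)]
      exact Ideal.mul_mem_left _ _ (Ideal.pow_mem_of_mem _ hbm _ (by omega))
    have hGm1 : G.coeff (m - 1) = 0 := by
      have hc0 : c (m - 1) = 0 := by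
        have := hc (m - 1) (by omega)
        rw [hm1] at this
        exact (mul_eq_zero.1 this.symm).resolve_left (pow_ne_zero _ hb)
      rw [hG, coeff_map, hgc]
      simp [d, hm, hc0]
    have hGi : ∃ i < m, G.coeff i ≠ 0 := by
      refine ⟨i₁, hi₁, ?_⟩
      rw [hG, coeff_map, hgc]
      simpa [d, hi₁] using hci
    obtain ⟨α, hα⟩ := IsAlgClosed.exists_root G (by
      rw [degree_eq_natDegree (by rintro h; simp [h] at hGm), hGdeg]
      exact_mod_cast hm.ne')
    obtain ⟨a, rfl⟩ := residue_surjective α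
    have hex := G.exists_taylor_coeff_ne_zero hm hGdeg hGm1 hGi (residue O a)
    have hcoeff (i : ℕ) :
        residue O ((taylor a g).coeff i) = (taylor (residue O a) G).coeff i := by
      rw [← coeff_map, map_taylor]
    have hex' : ∃ i, i < m ∧ (taylor (residue O a) G).coeff i ≠ 0 := hex
    classical
    obtain ⟨hlt, hne⟩ := Nat.find_spec hex'
    have hmin (i : ℕ) (hi : i < Nat.find hex') : (taylor (residue O a) G).coeff i = 0 := by
      have := Nat.find_min hex' hi
      push Not at this
      exact this (hi.trans hlt)
    obtain ⟨z, hz⟩ := ih (Nat.find hex') hlt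
      (Nat.pos_of_ne_zero fun h => hne (by rw [h, taylor_coeff_zero]; exact hα)) (taylor a g)
      (fun i hi => by rw [← residue_eq_zero_iff, hcoeff, hmin i hi])
      (by rw [← residue_ne_zero_iff_isUnit, hcoeff]; exact hne)
    exact ⟨z + a, by rw [IsRoot, ← taylor_eval]; exact hz⟩
  -- The coefficient of degree `m - 1` of `f(X + η)` is this Hasse derivative at `η`. Its constant
  -- term is `f.coeff (m - 1)` and its linear one is `m * f.coeff m`, a unit. As `η` reduces to `0`,
  -- the shift does not change the reduction of `f`.
  obtain ⟨η, hη, hroot⟩ := HenselianLocalRing.exists_isRoot_mem_maximalIdeal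
    (hasseDeriv (m - 1) f)
    (by rw [hasseDeriv_coeff]; exact Ideal.mul_mem_left _ _ (h0 _ (by omega)))
    (by
      rw [hasseDeriv_coeff, show 1 + (m - 1) = m by omega,
        Nat.choose_symm (by omega : 1 ≤ m), Nat.choose_one_right]
      refine IsUnit.mul ?_ h1
      rw [← residue_ne_zero_iff_isUnit, map_natCast]
      exact_mod_cast hm.ne')
  have hcoeff (i : ℕ) : residue O ((taylor η f).coeff i) = residue O (f.coeff i) := by
    rw [← coeff_map, map_taylor, (residue_eq_zero_iff η).2 hη, taylor_zero, coeff_map]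
  obtain ⟨z, hz⟩ := key (taylor η f)
    (fun i hi => by rw [← residue_eq_zero_iff, hcoeff, residue_eq_zero_iff]; exact h0 i hi)
    (by rw [← residue_ne_zero_iff_isUnit, hcoeff, residue_ne_zero_iff_isUnit]; exact h1)
    (by rw [taylor_coeff]; exact hroot)
  exact ⟨z + η, by rw [IsRoot, ← taylor_eval]; exact hz⟩

/-- A monic polynomial of positive degree over a henselian valuation ring with divisible value
group and algebraically closed residue field of characteristic zero has a root. -/
theorem HenselianLocalRing.exists_isRoot_of_monic {O : Type*} [CommRing O] [IsDomain O]
    [ValuationRing O] [HenselianLocalRing O] [IsAlgClosed (ResidueField O)]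
    [CharZero (ResidueField O)]
    (hdiv : ∀ (a : O) (n : ℕ), 0 < n → ∃ b : O, Associated (b ^ n) a)
    (f : O[X]) (hf : f.Monic) (hdeg : f.natDegree ≠ 0) : ∃ a : O, f.IsRoot a := by
  have hF : (f.map (residue O)).Monic := hf.map _
  obtain ⟨α, hα⟩ := IsAlgClosed.exists_root (f.map (residue O)) (by
    rw [degree_eq_natDegree hF.ne_zero, hf.natDegree_map]
    exact_mod_cast hdeg)
  obtain ⟨a, rfl⟩ := residue_surjective α
  have hcoeff (i : ℕ) : residue O ((taylor a f).coeff i) =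
      (taylor (residue O a) (f.map (residue O))).coeff i := by
    rw [← coeff_map, map_taylor]
  have hex : ∃ i, (taylor (residue O a) (f.map (residue O))).coeff i ≠ 0 := by
    by_contra! h
    exact hF.ne_zero ((taylor_eq_zero _ _).1 (Polynomial.ext h))
  classical
  obtain ⟨z, hz⟩ := HenselianLocalRing.exists_isRoot_of_multiplicity hdiv (Nat.find hex)
    (Nat.pos_of_ne_zero fun h => Nat.find_spec hex (by rw [h, taylor_coeff_zero]; exact hα))
    (taylor a f)
    (fun i hi => by
      rw [← residue_eq_zero_iff, hcoeff]; exact not_not.1 (Nat.find_min hex hi))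
    (by rw [← residue_ne_zero_iff_isUnit, hcoeff]; exact Nat.find_spec hex)
  exact ⟨z + a, by rw [IsRoot, ← taylor_eval]; exact hz⟩

/-- Every polynomial of positive degree over such a valuation ring has a root in a field that
contains the ring. -/
theorem HenselianLocalRing.exists_eval₂_eq_zero {O K : Type*} [CommRing O] [IsDomain O]
    [ValuationRing O] [HenselianLocalRing O] [IsAlgClosed (ResidueField O)]
    [CharZero (ResidueField O)] [Field K]
    (hdiv : ∀ (a : O) (n : ℕ), 0 < n → ∃ b : O, Associated (b ^ n) a)
    (φ : O →+* K) (hφ : Function.Injective φ)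
    (f : O[X]) (hdeg : f.natDegree ≠ 0) :
    ∃ a b : O, b ≠ 0 ∧ f.eval₂ φ (φ a / φ b) = 0 := by
  have hf : f ≠ 0 := by rintro rfl; simp at hdeg
  have hlc : φ f.leadingCoeff ≠ 0 := by
    rw [Ne, map_eq_zero_iff φ hφ]; exact leadingCoeff_ne_zero.2 hf
  -- The roots of the integral normalization are those of `f` multiplied by the leading coefficient.
  obtain ⟨z, hz⟩ := HenselianLocalRing.exists_isRoot_of_monic hdiv f.integralNormalization
    (monic_integralNormalization hf)
    (by rwa [natDegree_eq_of_degree_eq f.degree_integralNormalization])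
  refine ⟨z, f.leadingCoeff, leadingCoeff_ne_zero.2 hf, ?_⟩
  have h := integralNormalization_eval₂_leadingCoeff_mul (p := f) (by omega) φ
    (φ z / φ f.leadingCoeff)
  rw [mul_div_cancel₀ _ hlc, eval₂_at_apply, hz.eq_zero, map_zero] at h
  exact (mul_eq_zero.1 h.symm).resolve_left (pow_ne_zero _ hlc)

/-! ### The ring of Puiseux integers and the Newton–Puiseux theorem -/

namespace PlanarVectorField

/-- The embedding of the power series ring that sends the variable to `x ^ (-1/N)`. -/
noncomputable def rootPowerSeries (N : ℕ+) : PowerSeries ℂ →+* SeriesAtInfinity :=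
  (HahnSeries.embDomainRingHom (AddMonoidHom.mk' (fun n : ℕ => (n : ℚ) / (N : ℕ))
      (fun a b => by push_cast; ring))
    (fun a b h => by
      have hN : ((N : ℕ) : ℚ) ≠ 0 := by exact_mod_cast N.pos.ne'
      simpa [div_left_inj' hN] using h)
    (fun a b => by
      have hN : (0 : ℚ) < ((N : ℕ) : ℚ) := by exact_mod_cast N.pos
      simp [div_le_div_iff_of_pos_right hN])).comp
    (RingEquiv.toRingHom HahnSeries.toPowerSeries.symm)

theorem rootPowerSeries_coeff (N : ℕ+) (f : PowerSeries ℂ) (n : ℕ) :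
    (rootPowerSeries N f).coeff ((n : ℚ) / (N : ℕ)) = PowerSeries.coeff n f := by
  simp only [rootPowerSeries, RingHom.comp_apply]
  exact HahnSeries.embDomain_mk_coeff _ _

theorem rootPowerSeries_support (N : ℕ+) (f : PowerSeries ℂ) {q : ℚ}
    (hq : (rootPowerSeries N f).coeff q ≠ 0) : ∃ n : ℕ, q = (n : ℚ) / (N : ℕ) := by
  by_contra! h
  refine hq ?_
  simp only [rootPowerSeries, RingHom.comp_apply]
  apply HahnSeries.embDomain_of_notMem_range
  rintro ⟨n, hn⟩
  exact h n hn.symm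

theorem rootPowerSeries_C (N : ℕ+) (c : ℂ) :
    rootPowerSeries N (PowerSeries.C c) = HahnSeries.C c := by
  ext q
  by_cases hq : ∃ n : ℕ, q = (n : ℚ) / (N : ℕ)
  · obtain ⟨n, rfl⟩ := hq
    have hN : ((N : ℕ) : ℚ) ≠ 0 := by exact_mod_cast N.pos.ne'
    rw [rootPowerSeries_coeff, PowerSeries.coeff_C, HahnSeries.C_apply, HahnSeries.coeff_single]
    simp [hN]
  · rw [not_imp_comm.1 (rootPowerSeries_support N _) hq, HahnSeries.C_apply,
      HahnSeries.coeff_single_of_ne]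
    rintro rfl
    exact hq ⟨0, by simp⟩

theorem rootPowerSeries_X_pow (N : ℕ+) (k : ℕ) :
    rootPowerSeries N (PowerSeries.X ^ k) = HahnSeries.single ((k : ℚ) / (N : ℕ)) 1 := by
  ext q
  have hN : ((N : ℕ) : ℚ) ≠ 0 := by exact_mod_cast N.pos.ne'
  by_cases hq : ∃ n : ℕ, q = (n : ℚ) / (N : ℕ)
  · obtain ⟨n, rfl⟩ := hq
    rw [rootPowerSeries_coeff, PowerSeries.coeff_X_pow, HahnSeries.coeff_single]
    simp [div_left_inj' hN]
  · rw [not_imp_comm.1 (rootPowerSeries_support N _) hq, HahnSeries.coeff_single_of_ne]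
    rintro rfl
    exact hq ⟨k, rfl⟩

/-- Series supported on the non-negative multiples of `1 / N` come from power series. -/
theorem exists_rootPowerSeries_eq (N : ℕ+) (y : SeriesAtInfinity)
    (hy : ∀ q, y.coeff q ≠ 0 → ∃ n : ℕ, q = (n : ℚ) / (N : ℕ)) :
    ∃ f, rootPowerSeries N f = y := by
  refine ⟨PowerSeries.mk fun n => y.coeff ((n : ℚ) / (N : ℕ)), ?_⟩
  ext q
  by_cases hq : ∃ n : ℕ, q = (n : ℚ) / (N : ℕ)
  · obtain ⟨n, rfl⟩ := hq
    rw [rootPowerSeries_coeff, PowerSeries.coeff_mk]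
  · rw [not_imp_comm.1 (rootPowerSeries_support N _) hq, not_imp_comm.1 (hy q) hq]

theorem rootPowerSeries_range_le (N M : ℕ+) :
    (rootPowerSeries N).range ≤ (rootPowerSeries (N * M)).range := by
  rintro _ ⟨f, rfl⟩
  refine exists_rootPowerSeries_eq _ _ fun q hq => ?_
  obtain ⟨n, rfl⟩ := rootPowerSeries_support N f hq
  have hN : ((N : ℕ) : ℚ) ≠ 0 := by exact_mod_cast N.pos.ne'
  have hM : ((M : ℕ) : ℚ) ≠ 0 := by exact_mod_cast M.pos.ne'
  exact ⟨n * M, by push_cast; field_simp⟩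

theorem directed_rootPowerSeries_range :
    Directed (· ≤ ·) fun N : ℕ+ => (rootPowerSeries N).range := fun N M =>
  ⟨N * M, rootPowerSeries_range_le N M, by
    rw [mul_comm]; exact rootPowerSeries_range_le M N⟩

/-- The ring of Puiseux series near `x = ∞` without positive powers of `x`. -/
noncomputable def puiseuxIntegers : Subring SeriesAtInfinity :=
  ⨆ N : ℕ+, (rootPowerSeries N).range

theorem mem_puiseuxIntegers {y : SeriesAtInfinity} :
    y ∈ puiseuxIntegers ↔ ∃ (N : ℕ+) (f : PowerSeries ℂ), rootPowerSeries N f = y :=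
  Subring.mem_iSup_of_directed directed_rootPowerSeries_range

/-- `rootPowerSeries` with values in the ring of Puiseux integers. -/
noncomputable def rootPowerSeriesInt (N : ℕ+) : PowerSeries ℂ →+* puiseuxIntegers :=
  (rootPowerSeries N).codRestrict puiseuxIntegers fun f => mem_puiseuxIntegers.2 ⟨N, f, rfl⟩

theorem coe_rootPowerSeriesInt (N : ℕ+) (f : PowerSeries ℂ) :
    (rootPowerSeriesInt N f : SeriesAtInfinity) = rootPowerSeries N f := rfl

theorem exists_rootPowerSeriesInt_eq (y : puiseuxIntegers) :
    ∃ (N : ℕ+) (f : PowerSeries ℂ), rootPowerSeriesInt N f = y := by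
  obtain ⟨N, f, h⟩ := mem_puiseuxIntegers.1 y.2
  exact ⟨N, f, Subtype.ext h⟩

theorem single_mem_puiseuxIntegers {r : ℚ} (hr : 0 ≤ r) :
    HahnSeries.single r (1 : ℂ) ∈ puiseuxIntegers := by
  obtain ⟨N, hN⟩ : ∃ N : ℕ+, (N : ℕ) = r.den := ⟨⟨r.den, r.pos⟩, rfl⟩
  refine mem_puiseuxIntegers.2 ⟨N, PowerSeries.X ^ r.num.toNat, ?_⟩
  rw [rootPowerSeries_X_pow, hN]
  congr 2
  have : ((r.num.toNat : ℕ) : ℚ) = (r.num : ℚ) := by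
    exact_mod_cast Int.toNat_of_nonneg (Rat.num_nonneg.2 hr)
  rw [this]
  exact Rat.num_div_den r

/-- The power `x ^ (-r)`, for `r ≥ 0`, as a Puiseux integer. -/
noncomputable def uniformizerPow (r : ℚ) (hr : 0 ≤ r) : puiseuxIntegers :=
  ⟨HahnSeries.single r 1, single_mem_puiseuxIntegers hr⟩

/-- In `ℂ⟦t⟧` with `t = x^(-1/N)` a nonzero series is a power of `t` times a unit. Divisibility is
thereby reduced to comparing rational exponents. -/
theorem exists_eq_uniformizerPow_mul (y : puiseuxIntegers) (hy : y ≠ 0) :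
    ∃ (r : ℚ) (hr : 0 ≤ r) (u : puiseuxIntegersˣ), y = uniformizerPow r hr * u := by
  obtain ⟨N, f, rfl⟩ := exists_rootPowerSeriesInt_eq y
  have hf : f ≠ 0 := by rintro rfl; simp at hy
  obtain ⟨v, hv⟩ := PowerSeries.isUnit_divided_by_X_pow_order hf
  refine ⟨(f.order.toNat : ℚ) / (N : ℕ), by positivity,
    Units.map (rootPowerSeriesInt N : PowerSeries ℂ →* puiseuxIntegers) v, Subtype.ext ?_⟩
  simp only [Subring.coe_mul, Units.coe_map, MonoidHom.coe_coe, coe_rootPowerSeriesInt,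
    uniformizerPow]
  rw [← rootPowerSeries_X_pow, ← map_mul, hv, PowerSeries.X_pow_order_mul_divXPowOrder]

theorem uniformizerPow_add (r s : ℚ) (hr : 0 ≤ r) (hs : 0 ≤ s) :
    uniformizerPow (r + s) (add_nonneg hr hs) = uniformizerPow r hr * uniformizerPow s hs :=
  Subtype.ext (by simp [uniformizerPow, HahnSeries.single_mul_single])

theorem uniformizerPow_pow (r : ℚ) (hr : 0 ≤ r) (n : ℕ) :
    uniformizerPow r hr ^ n = uniformizerPow (n * r) (by positivity) :=
  Subtype.ext (by simp [uniformizerPow])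

instance : ValuationRing puiseuxIntegers := by
  refine ValuationRing.iff_dvd_total.2 ⟨fun a b => ?_⟩
  rcases eq_or_ne a 0 with rfl | ha
  · exact Or.inr (dvd_zero b)
  rcases eq_or_ne b 0 with rfl | hb
  · exact Or.inl (dvd_zero a)
  obtain ⟨r, hr, u, rfl⟩ := exists_eq_uniformizerPow_mul a ha
  obtain ⟨s, hs, v, rfl⟩ := exists_eq_uniformizerPow_mul b hb
  rw [Units.mul_right_dvd, Units.dvd_mul_right, Units.mul_right_dvd, Units.dvd_mul_right]
  have key : ∀ (r s : ℚ) (hr : 0 ≤ r) (hs : 0 ≤ s), r ≤ s →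
      uniformizerPow r hr ∣ uniformizerPow s hs := fun r s hr hs h =>
    ⟨uniformizerPow (s - r) (sub_nonneg.2 h), by
      rw [← uniformizerPow_add]; simp⟩
  exact (le_total r s).imp (key r s hr hs) (key s r hs hr)

theorem puiseuxIntegers_exists_associated_pow (a : puiseuxIntegers) (n : ℕ) (hn : 0 < n) :
    ∃ b : puiseuxIntegers, Associated (b ^ n) a := by
  rcases eq_or_ne a 0 with rfl | ha
  · exact ⟨0, by rw [zero_pow hn.ne']⟩
  obtain ⟨r, hr, u, rfl⟩ := exists_eq_uniformizerPow_mul a ha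
  refine ⟨uniformizerPow (r / n) (by positivity), u, ?_⟩
  rw [uniformizerPow_pow]
  congr 2
  field_simp

theorem rootPowerSeriesInt_range_mono (N M : ℕ+) :
    (rootPowerSeriesInt N).range ≤ (rootPowerSeriesInt (N * M)).range := by
  rintro _ ⟨f, rfl⟩
  obtain ⟨g, hg⟩ := rootPowerSeries_range_le N M ⟨f, rfl⟩
  exact ⟨g, Subtype.ext hg⟩

/-- A common multiple of the denominators works, so questions about finitely many Puiseux integers
can be settled in a single power series ring. -/
theorem exists_forall_mem_rootPowerSeriesInt_range (s : Finset puiseuxIntegers) :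
    ∃ N : ℕ+, ∀ y ∈ s, y ∈ (rootPowerSeriesInt N).range := by
  classical
  induction s using Finset.induction_on with
  | empty => exact ⟨1, by simp⟩
  | insert a s _ ih =>
    obtain ⟨N, hN⟩ := ih
    obtain ⟨M, f, hf⟩ := exists_rootPowerSeriesInt_eq a
    refine ⟨N * M, fun y hy => ?_⟩
    rcases Finset.mem_insert.1 hy with rfl | hy
    · rw [mul_comm]
      exact rootPowerSeriesInt_range_mono M N ⟨f, hf⟩
    · exact rootPowerSeriesInt_range_mono N M (hN y hy)

theorem rootPowerSeriesInt_coeff_zero (N : ℕ+) (f : PowerSeries ℂ) :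
    (rootPowerSeriesInt N f : SeriesAtInfinity).coeff 0 = PowerSeries.constantCoeff f := by
  have := rootPowerSeries_coeff N f 0
  simpa [coe_rootPowerSeriesInt] using this

theorem rootPowerSeriesInt_injective (N : ℕ+) : Function.Injective (rootPowerSeriesInt N) := by
  intro f g h
  ext n
  rw [← rootPowerSeries_coeff N, ← rootPowerSeries_coeff N, ← coe_rootPowerSeriesInt, h,
    coe_rootPowerSeriesInt]

theorem puiseuxIntegers_isUnit_iff (y : puiseuxIntegers) :
    IsUnit y ↔ (y : SeriesAtInfinity).coeff 0 ≠ 0 := by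
  classical
  constructor
  · intro hy
    obtain ⟨z, hz⟩ := hy.exists_right_inv
    obtain ⟨N, hN⟩ := exists_forall_mem_rootPowerSeriesInt_range {y, z}
    obtain ⟨f, rfl⟩ := hN y (by simp)
    obtain ⟨g, rfl⟩ := hN z (by simp)
    rw [rootPowerSeriesInt_coeff_zero]
    rw [← map_mul, ← map_one (rootPowerSeriesInt N)] at hz
    have h := congrArg PowerSeries.constantCoeff (rootPowerSeriesInt_injective N hz)
    rw [map_mul, map_one] at h
    exact left_ne_zero_of_mul_eq_one h
  · intro hy
    obtain ⟨N, f, rfl⟩ := exists_rootPowerSeriesInt_eq y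
    rw [rootPowerSeriesInt_coeff_zero] at hy
    exact (PowerSeries.isUnit_iff_constantCoeff.2 hy.isUnit).map _

theorem puiseuxIntegers_mem_maximalIdeal (y : puiseuxIntegers) :
    y ∈ maximalIdeal puiseuxIntegers ↔ (y : SeriesAtInfinity).coeff 0 = 0 := by
  rw [mem_maximalIdeal, mem_nonunits_iff, puiseuxIntegers_isUnit_iff, not_not]

/-- The coefficients of `f` and the approximate root lie in one `ℂ⟦t⟧`, which is henselian along
`(t)`; the root found there is mapped back. -/
instance : HenselianLocalRing puiseuxIntegers where
  is_henselian f hf a₀ h0 h1 := by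
    classical
    obtain ⟨N, hN⟩ := exists_forall_mem_rootPowerSeriesInt_range (insert a₀ (insert 0 f.coeffs))
    have hlift : f ∈ lifts (rootPowerSeriesInt N) := by
      rw [lifts_iff_coeff_lifts]
      intro i
      by_cases hi : f.coeff i = 0
      · rw [hi]; exact ⟨0, map_zero _⟩
      · exact hN _ (by simp [coeff_mem_coeffs hi])
    obtain ⟨g, rfl, -, hg⟩ := lifts_and_degree_eq_and_monic hlift hf
    obtain ⟨α, rfl⟩ := hN a₀ (by simp)
    rw [eval_map_apply, puiseuxIntegers_mem_maximalIdeal, rootPowerSeriesInt_coeff_zero] at h0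
    rw [derivative_map, eval_map_apply, puiseuxIntegers_isUnit_iff,
      rootPowerSeriesInt_coeff_zero] at h1
    have hspan (p : PowerSeries ℂ) : p ∈ Ideal.span {(PowerSeries.X : PowerSeries ℂ)} ↔
        PowerSeries.constantCoeff p = 0 := by
      rw [Ideal.mem_span_singleton, PowerSeries.X_dvd_iff]
    obtain ⟨β, hβ, hβα⟩ := HenselianRing.is_henselian
      (I := Ideal.span {(PowerSeries.X : PowerSeries ℂ)}) g hg α ((hspan _).2 h0)
      ((PowerSeries.isUnit_iff_constantCoeff.2 h1.isUnit).map _)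
    refine ⟨rootPowerSeriesInt N β, ?_, ?_⟩
    · rw [IsRoot, eval_map_apply, hβ.eq_zero, map_zero]
    · rw [← map_sub, puiseuxIntegers_mem_maximalIdeal, rootPowerSeriesInt_coeff_zero]
      exact (hspan _).1 hβα

/-- Complex constants as elements of the residue field of the Puiseux integers. -/
noncomputable def residueConst : ℂ →+* ResidueField puiseuxIntegers :=
  (residue puiseuxIntegers).comp ((rootPowerSeriesInt 1).comp PowerSeries.C)

theorem residueConst_bijective : Function.Bijective residueConst := by
  refine ⟨residueConst.injective, fun y => ?_⟩
  obtain ⟨y, rfl⟩ := residue_surjective y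
  refine ⟨(y : SeriesAtInfinity).coeff 0, ?_⟩
  rw [residueConst, RingHom.comp_apply, ← sub_eq_zero, ← map_sub, residue_eq_zero_iff,
    puiseuxIntegers_mem_maximalIdeal]
  simp only [RingHom.comp_apply, AddSubgroupClass.coe_sub, HahnSeries.coeff_sub,
    rootPowerSeriesInt_coeff_zero, PowerSeries.constantCoeff_C, sub_self]

instance : IsAlgClosed (ResidueField puiseuxIntegers) :=
  IsAlgClosed.of_ringEquiv ℂ _ (RingEquiv.ofBijective residueConst residueConst_bijective)

instance : CharZero (ResidueField puiseuxIntegers) :=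
  charZero_of_injective_ringHom residueConst.injective

theorem isPuiseux_div (a b : puiseuxIntegers) (hb : b ≠ 0) :
    IsPuiseux ((a : SeriesAtInfinity) / b) := by
  obtain ⟨r, hr, u, rfl⟩ := exists_eq_uniformizerPow_mul b hb
  obtain ⟨N, f, hf⟩ := exists_rootPowerSeriesInt_eq (a * (u⁻¹ : puiseuxIntegersˣ))
  have hdiv : (a : SeriesAtInfinity) / ((uniformizerPow r hr * u : puiseuxIntegers) :
      SeriesAtInfinity) = HahnSeries.single (-r) 1 * rootPowerSeries N f := by
    rw [div_eq_iff fun h => hb (Subtype.ext h)]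
    have ha : a = rootPowerSeriesInt N f * u := by rw [hf, mul_assoc, Units.inv_mul, mul_one]
    have h1 : (HahnSeries.single (-r) 1 * HahnSeries.single r 1 : SeriesAtInfinity) = 1 := by
      rw [HahnSeries.single_mul_single, neg_add_cancel, one_mul]
      rfl
    rw [ha]
    simp only [Subring.coe_mul, uniformizerPow, coe_rootPowerSeriesInt]
    linear_combination (-(rootPowerSeries N f) * (u : puiseuxIntegers)) * h1
  rw [hdiv]
  -- The quotient is `x^r` times a series in `x^(-1/N)`, and `r - n/N = (r.num * N - n * r.den) /
  -- (r.den * N)`.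
  refine ⟨r.num * N, r.den * N, Nat.mul_pos r.pos N.pos, fun q hq => ?_⟩
  rw [HahnSeries.mem_support, HahnSeries.coeff_single_mul, one_mul] at hq
  obtain ⟨n, hn⟩ := rootPowerSeries_support N f hq
  refine ⟨n * r.den, ?_⟩
  have hN : ((N : ℕ) : ℚ) ≠ 0 := by exact_mod_cast N.pos.ne'
  have hd : (r.den : ℚ) ≠ 0 := by exact_mod_cast r.den_nz
  have hq' : q = (n : ℚ) / (N : ℕ) - r := by linarith
  have hr' : r = r.num / r.den := (Rat.num_div_den r).symm
  rw [hq']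
  conv_lhs => rw [hr']
  push_cast
  field_simp
  ring

/-- **Newton–Puiseux theorem**: a polynomial of positive degree over the ring of Puiseux integers
has a Puiseux series as a root. -/
theorem exists_isPuiseux_eval₂_eq_zero (f : puiseuxIntegers[X]) (hdeg : f.natDegree ≠ 0) :
    ∃ y, IsPuiseux y ∧ f.eval₂ puiseuxIntegers.subtype y = 0 := by
  obtain ⟨a, b, hb, h⟩ := HenselianLocalRing.exists_eval₂_eq_zero
    puiseuxIntegers_exists_associated_pow puiseuxIntegers.subtype Subtype.val_injective f hdeg
  exact ⟨_, isPuiseux_div a b hb, h⟩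

end PlanarVectorField

/-! ### Differentiation of series and the chain rule -/

namespace PlanarVectorField

theorem seriesDeriv_coeff (y : SeriesAtInfinity) (r : ℚ) :
    (seriesDeriv y).coeff r = (1 - (r : ℂ)) * y.coeff (r - 1) := rfl

/-- The Euler operator `x ∂/∂x` on series. -/
noncomputable def seriesEuler (y : SeriesAtInfinity) : SeriesAtInfinity where
  coeff q := -(q : ℂ) * y.coeff q
  isPWO_support' := y.isPWO_support.mono fun _ hq => right_ne_zero_of_mul hq

theorem seriesEuler_coeff (y : SeriesAtInfinity) (q : ℚ) :
    (seriesEuler y).coeff q = -(q : ℂ) * y.coeff q := rfl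

/-- The Euler operator leaves every exponent in place, so the product rule is easier for it; the
factor `x^(-1)` is then restored. -/
theorem seriesDeriv_eq (y : SeriesAtInfinity) :
    seriesDeriv y = HahnSeries.single 1 1 * seriesEuler y := by
  ext r
  rw [seriesDeriv_coeff, HahnSeries.coeff_single_mul, seriesEuler_coeff]
  push_cast
  ring

theorem seriesEuler_mul (y z : SeriesAtInfinity) :
    seriesEuler (y * z) = seriesEuler y * z + y * seriesEuler z := by
  have hs (w : SeriesAtInfinity) : (seriesEuler w).support ⊆ w.support :=
    fun _ hq => right_ne_zero_of_mul hq
  ext q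
  rw [HahnSeries.coeff_add, seriesEuler_coeff, HahnSeries.coeff_mul,
    -- All three sums are taken over the antidiagonal of the supports of `y` and `z`; there `q = i +
    -- j`, and the identity holds term by term.
    HahnSeries.coeff_mul_left' y.isPWO_support (hs y),
    HahnSeries.coeff_mul_right' z.isPWO_support (hs z), ← Finset.sum_add_distrib, Finset.mul_sum]
  refine Finset.sum_congr rfl fun ij hij => ?_
  have hq : q = ij.1 + ij.2 := (Finset.mem_antidiagonal.1 hij).2.2.symm
  rw [seriesEuler_coeff, seriesEuler_coeff, hq]
  push_cast
  ring

theorem seriesDeriv_mul (y z : SeriesAtInfinity) :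
    seriesDeriv (y * z) = seriesDeriv y * z + y * seriesDeriv z := by
  simp only [seriesDeriv_eq, seriesEuler_mul]
  ring

theorem seriesDeriv_add (y z : SeriesAtInfinity) :
    seriesDeriv (y + z) = seriesDeriv y + seriesDeriv z := by
  ext r
  simp only [HahnSeries.coeff_add, seriesDeriv_coeff]
  ring

theorem seriesDeriv_C (c : ℂ) : seriesDeriv (HahnSeries.C c) = 0 := by
  ext r
  rw [seriesDeriv_coeff, HahnSeries.C_apply, HahnSeries.coeff_single, HahnSeries.coeff_zero]
  split_ifs with h
  · have : r = 1 := by linarith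
    simp [this]
  · simp

theorem seriesDeriv_seriesX : seriesDeriv seriesX = 1 := by
  ext r
  rw [seriesDeriv_coeff, seriesX, HahnSeries.coeff_single, HahnSeries.coeff_one]
  by_cases h : r = 0
  · simp [h]
  · rw [if_neg h, if_neg (by intro h'; exact h (by linarith)), mul_zero]

/-- Substitution of a series as a ring homomorphism. -/
noncomputable def substSeriesHom (y : SeriesAtInfinity) : Poly2 →+* SeriesAtInfinity :=
  MvPolynomial.eval₂Hom HahnSeries.C ![seriesX, y]

theorem substSeries_eq (F : Poly2) (y : SeriesAtInfinity) :
    substSeries F y = substSeriesHom y F := rfl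

/-- The chain rule. -/
theorem seriesDeriv_substSeries (F : Poly2) (y : SeriesAtInfinity) :
    seriesDeriv (substSeries F y) = substSeries (MvPolynomial.pderiv 0 F) y +
      substSeries (MvPolynomial.pderiv 1 F) y * seriesDeriv y := by
  simp only [substSeries_eq]
  induction F using MvPolynomial.induction_on with
  | C a =>
    simp only [substSeriesHom, MvPolynomial.coe_eval₂Hom, MvPolynomial.eval₂_C, seriesDeriv_C,
      MvPolynomial.pderiv_C, MvPolynomial.eval₂_zero, zero_mul, add_zero]
  | add p q hp hq =>
    simp only [map_add, seriesDeriv_add, hp, hq]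
    ring
  | mul_X p i hp =>
    have hX : seriesDeriv (substSeriesHom y (MvPolynomial.X i)) =
        substSeriesHom y (MvPolynomial.pderiv 0 (MvPolynomial.X i)) +
        substSeriesHom y (MvPolynomial.pderiv 1 (MvPolynomial.X i)) * seriesDeriv y := by
      fin_cases i
      · simp [substSeriesHom, seriesDeriv_seriesX]
      · simp [substSeriesHom]
    simp only [map_mul, seriesDeriv_mul, Derivation.leibniz, smul_eq_mul, map_add, hX, hp]
    ring

theorem seriesX_pow (n : ℕ) : seriesX ^ n = HahnSeries.single (-(n : ℚ)) 1 := by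
  simp [seriesX]

/-! ### Puiseux roots of bivariate polynomials -/

/-- Every polynomial that depends on `y` vanishes along some Puiseux series. -/
theorem exists_isPuiseux_substSeries_eq_zero (F : Poly2) (hF : MvPolynomial.pderiv 1 F ≠ 0) :
    ∃ y, IsPuiseux y ∧ substSeries F y = 0 := by
  obtain ⟨d, hd, hd1⟩ : ∃ d ∈ F.support, d 1 ≠ 0 := by
    by_contra! h
    refine hF (MvPolynomial.pderiv_eq_zero_of_notMem_vars ?_)
    rw [MvPolynomial.mem_vars_iff_mem_support]
    rintro ⟨d, hd, hd'⟩
    exact Finsupp.mem_support_iff.1 hd' (h d hd)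
  -- Multiplication by `x^(-D)` removes all positive powers of `x`, which makes the coefficients
  -- Puiseux integers.
  set D := F.degreeOf 0
  let a : (Fin 2 →₀ ℕ) → puiseuxIntegers := fun d =>
    rootPowerSeriesInt 1 (PowerSeries.C (F.coeff d)) *
      uniformizerPow ((D - d 0 : ℕ) : ℚ) (Nat.cast_nonneg _)
  have ha (d : Fin 2 →₀ ℕ) :
      (a d : SeriesAtInfinity) = HahnSeries.single ((D - d 0 : ℕ) : ℚ) (F.coeff d) := by
    simp only [a, Subring.coe_mul, coe_rootPowerSeriesInt, rootPowerSeries_C, uniformizerPow,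
      HahnSeries.C_apply, HahnSeries.single_mul_single, zero_add, mul_one]
  let f : puiseuxIntegers[X] := ∑ d ∈ F.support, monomial (d 1) (a d)
  have hdeg : f.natDegree ≠ 0 := by
    -- Monomials with equal `y`-exponent have distinct `x`-exponents, so nothing cancels. Since `D -
    -- d 0` is truncated, the bounds by `D` are needed to recover `d 0`.
    have hc : f.coeff (d 1) ≠ 0 := by
      intro h0
      have h1 : (puiseuxIntegers.subtype (f.coeff (d 1))).coeff ((D - d 0 : ℕ) : ℚ) = 0 := by
        rw [h0]; simp
      simp only [f, finsetSum_coeff, coeff_monomial, map_sum, HahnSeries.coeff_sum] at h1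
      rw [Finset.sum_eq_single d] at h1
      · rw [if_pos rfl, Subring.subtype_apply, ha, HahnSeries.coeff_single_same] at h1
        exact MvPolynomial.mem_support_iff.1 hd h1
      · intro d' hd' hne
        split_ifs with h
        · rw [Subring.subtype_apply, ha, HahnSeries.coeff_single_of_ne]
          intro h'
          have h2 : D - d 0 = D - d' 0 := by exact_mod_cast h'
          have h3 := MvPolynomial.monomial_le_degreeOf 0 hd
          have h4 := MvPolynomial.monomial_le_degreeOf 0 hd'
          refine hne (Finsupp.ext fun i => ?_)
          fin_cases i
          · change d' 0 = d 0
            change d 0 ≤ D at h3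
            change d' 0 ≤ D at h4
            omega
          · exact h
        · simp
      · exact fun h => absurd hd h
    exact fun h => hd1 (Nat.le_zero.1 (h ▸ le_natDegree_of_ne_zero hc))
  obtain ⟨y, hy, hroot⟩ := exists_isPuiseux_eval₂_eq_zero f hdeg
  refine ⟨y, hy, ?_⟩
  have hmul : f.eval₂ puiseuxIntegers.subtype y = HahnSeries.single (D : ℚ) 1 * substSeries F y := by
    rw [substSeries, MvPolynomial.eval₂_eq', Finset.mul_sum]
    simp only [f, eval₂_finsetSum, eval₂_monomial, Subring.subtype_apply, ha]
    refine Finset.sum_congr rfl fun d hd => ?_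
    have h3 : d 0 ≤ D := MvPolynomial.monomial_le_degreeOf 0 hd
    rw [Fin.prod_univ_two]
    simp only [Matrix.cons_val_zero, Matrix.cons_val_one]
    rw [seriesX_pow, HahnSeries.C_apply, ← mul_assoc, ← mul_assoc, HahnSeries.single_mul_single,
      HahnSeries.single_mul_single]
    rw [one_mul, mul_one]
    congr 3
    push_cast [Nat.cast_sub h3]
    ring
  rw [hmul] at hroot
  exact (mul_eq_zero.1 hroot).resolve_left (HahnSeries.single_ne_zero one_ne_zero)

/-! ### Common roots, divisibility and solutions of the equation -/

/-- The embedding of `ℂ[x]` into the field of series. -/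
noncomputable def polySeries : ℂ[X] →+* SeriesAtInfinity :=
  eval₂RingHom HahnSeries.C seriesX

theorem polySeries_coeff (p : ℂ[X]) (n : ℕ) : (polySeries p).coeff (-(n : ℚ)) = p.coeff n := by
  induction p using Polynomial.induction_on' with
  | add p q hp hq => rw [map_add, HahnSeries.coeff_add, hp, hq, coeff_add]
  | monomial m a =>
    rw [polySeries, coe_eval₂RingHom, eval₂_monomial, seriesX_pow, HahnSeries.C_apply,
      HahnSeries.single_mul_single, zero_add, mul_one, HahnSeries.coeff_single, coeff_monomial]
    simp [eq_comm]

theorem polySeries_injective : Function.Injective polySeries := by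
  intro p q h
  ext n
  rw [← polySeries_coeff, ← polySeries_coeff, h]

theorem substSeries_equivMvPolynomial (p : ℂ[X][X]) (y : SeriesAtInfinity) :
    substSeries (Bivariate.equivMvPolynomial ℂ p) y = p.eval₂ polySeries y := by
  rw [substSeries_eq]
  change ((substSeriesHom y).comp (Bivariate.equivMvPolynomial ℂ).toRingEquiv.toRingHom) p =
    eval₂RingHom polySeries y p
  congr 1
  refine Polynomial.ringHom_ext' (Polynomial.ringHom_ext ?_ ?_) ?_
  · intro a; simp [substSeriesHom, polySeries]
  · simp [substSeriesHom, polySeries]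
  · simp [substSeriesHom]

/-- An irreducible polynomial of positive degree divides every polynomial with which it shares a
root in a field that contains the coefficients. -/
theorem _root_.Polynomial.dvd_of_irreducible_of_eval₂_eq_zero {R K : Type*} [CommRing R]
    [IsDomain R] [NormalizedGCDMonoid R] [Field K] (φ : R →+* K) (hφ : Function.Injective φ)
    {p q : R[X]} (hp : Irreducible p) (hdeg : p.natDegree ≠ 0) {y : K} (h1 : p.eval₂ φ y = 0)
    (h2 : q.eval₂ φ y = 0) : p ∣ q := by
  have hprim := hp.isPrimitive hdeg
  rw [hprim.dvd_iff_fraction_map_dvd_fraction_map (FractionRing R)]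
  rw [hprim.irreducible_iff_irreducible_map_fraction_map (K := FractionRing R)] at hp
  -- By Gauss's lemma `p` stays irreducible over the fraction field; a Bézout identity evaluated at
  -- the common root would read `0 = 1`.
  by_contra hnd
  obtain ⟨U, V, hUV⟩ := (hp.coprime_iff_not_dvd).2 hnd
  let ψ : FractionRing R →+* K := IsFractionRing.lift hφ
  have hψ : ψ.comp (algebraMap R (FractionRing R)) = φ :=
    RingHom.ext fun r => IsFractionRing.lift_algebraMap hφ r
  have := congrArg (eval₂ ψ y) hUV
  rw [eval₂_add, eval₂_mul, eval₂_mul, eval₂_map, eval₂_map, hψ, h1, h2] at this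
  simp at this

/-- The polynomials vanishing along a series are the multiples of an irreducible one. -/
theorem dvd_of_substSeries_eq_zero {F G : Poly2} (hF : Irreducible F)
    (hFy : MvPolynomial.pderiv 1 F ≠ 0) {y : SeriesAtInfinity} (h1 : substSeries F y = 0)
    (h2 : substSeries G y = 0) : F ∣ G := by
  obtain ⟨p, rfl⟩ := (Bivariate.equivMvPolynomial ℂ).surjective F
  obtain ⟨q, rfl⟩ := (Bivariate.equivMvPolynomial ℂ).surjective G
  rw [MulEquiv.irreducible_iff] at hF
  rw [Bivariate.pderiv_one_equivMvPolynomial, Ne, map_eq_zero_iff _ (AlgEquiv.injective _)] at hFy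
  rw [substSeries_equivMvPolynomial] at h1 h2
  refine map_dvd _ ?_
  have hdeg : p.natDegree ≠ 0 := fun h => hFy (by rw [eq_C_of_natDegree_eq_zero h, derivative_C])
  exact dvd_of_irreducible_of_eval₂_eq_zero polySeries polySeries_injective hF hdeg h1 h2

theorem not_dvd_pderiv_one {F : Poly2} (hFy : MvPolynomial.pderiv 1 F ≠ 0) :
    ¬ F ∣ MvPolynomial.pderiv 1 F := by
  obtain ⟨p, rfl⟩ := (Bivariate.equivMvPolynomial ℂ).surjective F
  rw [Bivariate.pderiv_one_equivMvPolynomial, Ne, map_eq_zero_iff _ (AlgEquiv.injective _)] at hFy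
  rw [Bivariate.pderiv_one_equivMvPolynomial, map_dvd_iff]
  refine not_dvd_of_degree_lt hFy (degree_derivative_lt ?_)
  rintro rfl
  simp at hFy

theorem vectorField_apply (P Q F : Poly2) :
    vectorField P Q F = P * MvPolynomial.pderiv 0 F + Q * MvPolynomial.pderiv 1 F := by
  simp [vectorField]

/-- A Puiseux root of an irreducible invariant curve is a solution of the equation. -/
theorem mem_puiseuxSolutions {P Q F : Poly2} (hF : Irreducible F) (hinv : IsInvariantCurve P Q F)
    (hFy : MvPolynomial.pderiv 1 F ≠ 0) {y : SeriesAtInfinity} (hy : IsPuiseux y)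
    (h : substSeries F y = 0) : y ∈ puiseuxSolutions P Q := by
  refine ⟨hy, ?_⟩
  obtain ⟨-, L, hL⟩ := hinv
  have hne : substSeries (MvPolynomial.pderiv 1 F) y ≠ 0 := fun h0 =>
    not_dvd_pderiv_one hFy (dvd_of_substSeries_eq_zero hF hFy h h0)
  have hchain := seriesDeriv_substSeries F y
  have h0 : seriesDeriv (0 : SeriesAtInfinity) = 0 := by ext; simp [seriesDeriv_coeff]
  rw [h, h0] at hchain
  rw [vectorField_apply] at hL
  have hL' := congrArg (substSeriesHom y) hL
  simp only [map_add, map_mul, ← substSeries_eq, h, mul_zero] at hL'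
  refine (mul_eq_zero.1 ?_).resolve_left hne
  -- Eliminates `F_x` between `F_x + F_y y_x = 0` and `P F_x + Q F_y = 0`.
  linear_combination -(substSeries P y) * hchain - hL'

end PlanarVectorField

/-! ### Counting invariant curves -/

namespace PlanarVectorField

theorem encard_irreducibleInvariantCurvesInY_le (P Q : Poly2) :
    (irreducibleInvariantCurvesInY P Q).encard ≤ (puiseuxSolutions P Q).encard := by
  have hex (a : Associates Poly2) : ∃ y : SeriesAtInfinity, a ∈ irreducibleInvariantCurvesInY P Q →
      y ∈ puiseuxSolutions P Q ∧ ∃ F : Poly2, Associates.mk F = a ∧ Irreducible F ∧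
        MvPolynomial.pderiv 1 F ≠ 0 ∧ substSeries F y = 0 := by
    by_cases ha : a ∈ irreducibleInvariantCurvesInY P Q
    · obtain ⟨F, ⟨hF, hinv, hFy⟩, rfl⟩ := ha
      obtain ⟨y, hy, h⟩ := exists_isPuiseux_substSeries_eq_zero F hFy
      exact ⟨y, fun _ => ⟨mem_puiseuxSolutions hF hinv hFy hy h, F, rfl, hF, hFy, h⟩⟩
    · exact ⟨0, fun h => absurd h ha⟩
  choose g hg using hex
  refine Set.encard_le_encard_of_injOn (f := g) (fun a ha => (hg a ha).1) fun a ha b hb hab => ?_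
  obtain ⟨-, F, rfl, hF, hFy, h1⟩ := hg a ha
  obtain ⟨-, G, rfl, hG, hGy, h2⟩ := hg b hb
  rw [← hab] at h2
  exact Associates.mk_eq_mk_iff_associated.2 (associated_of_dvd_dvd
    (dvd_of_substSeries_eq_zero hF hFy h1 h2) (dvd_of_substSeries_eq_zero hG hGy h2 h1))

/-- An invariant curve that does not depend on `y` divides `P`. -/
theorem dvd_of_pderiv_one_eq_zero {P Q F : Poly2} (hF : Irreducible F)
    (hinv : IsInvariantCurve P Q F) (hFy : MvPolynomial.pderiv 1 F = 0) : F ∣ P := by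
  obtain ⟨hconst, L, hL⟩ := hinv
  rw [vectorField_apply, hFy, mul_zero, add_zero] at hL
  -- Invariance now reads `P F_x = L F`. If `F` divided `F_x`, comparing degrees in `x` would give
  -- `F_x = 0` and `F` would be constant.
  refine (hF.prime.dvd_or_dvd ⟨L, by rw [hL, mul_comm]⟩).resolve_right ?_
  obtain ⟨p, rfl⟩ := (Bivariate.equivMvPolynomial ℂ).surjective F
  rw [Bivariate.pderiv_one_equivMvPolynomial, map_eq_zero_iff _ (AlgEquiv.injective _)] at hFy
  rw [eq_C_of_natDegree_eq_zero (derivative_eq_zero.1 hFy)] at hconst ⊢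
  set a := p.coeff 0
  have he (a : ℂ[X]) : Bivariate.equivMvPolynomial ℂ (C a) = aeval (MvPolynomial.X 0) a := by
    simp [Bivariate.equivMvPolynomial, aevalAeval, aeval_def, eval_map, MvPolynomial.algebraMap_eq]
  have hd : MvPolynomial.pderiv 0 (Bivariate.equivMvPolynomial ℂ (C a)) =
      Bivariate.equivMvPolynomial ℂ (C (derivative a)) := by
    rw [he, he, Derivation.map_aeval]
    simp
  rw [hd, map_dvd_iff, C_dvd_iff_dvd_coeff]
  intro h
  have h0 : a ∣ derivative a := by simpa using h 0
  have ha : derivative a = 0 := by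
    by_contra hne
    refine not_dvd_of_degree_lt hne (degree_derivative_lt ?_) h0
    rintro h'
    simp [h'] at hne
  rw [eq_C_of_natDegree_eq_zero (derivative_eq_zero.1 ha)] at hconst
  exact hconst ⟨_, (Bivariate.equivMvPolynomial_C_C).symm⟩

theorem _root_.Associates.finite_irreducible_dvd {R : Type*} [CommRing R] [IsDomain R]
    [UniqueFactorizationMonoid R] {a : R} (ha : a ≠ 0) :
    (Associates.mk '' {p : R | Irreducible p ∧ p ∣ a}).Finite := by
  classical
  refine ((UniqueFactorizationMonoid.factors a).toFinset.finite_toSet.image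
    Associates.mk).subset ?_
  rintro _ ⟨p, ⟨hp, hpa⟩, rfl⟩
  obtain ⟨q, hq, hpq⟩ := UniqueFactorizationMonoid.exists_mem_factors_of_dvd ha hp hpa
  exact ⟨q, by simpa using hq, (Associates.mk_eq_mk_iff_associated.2 hpq).symm⟩

theorem finite_irreducibleInvariantCurves {P Q : Poly2} (hP : P ≠ 0)
    (hfin : (puiseuxSolutions P Q).Finite) : (irreducibleInvariantCurves P Q).Finite := by
  have hY : (irreducibleInvariantCurvesInY P Q).Finite :=
    Set.encard_lt_top_iff.1
      ((encard_irreducibleInvariantCurvesInY_le P Q).trans_lt (Set.encard_lt_top_iff.2 hfin))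
  refine (hY.union (Associates.finite_irreducible_dvd hP)).subset ?_
  rintro _ ⟨F, ⟨hF, hinv⟩, rfl⟩
  by_cases hFy : MvPolynomial.pderiv 1 F = 0
  · exact Or.inr ⟨F, ⟨hF, dvd_of_pderiv_one_eq_zero hF hinv hFy⟩, rfl⟩
  · exact Or.inl ⟨F, ⟨hF, hinv, hFy⟩, rfl⟩

/-! ### Rational first integrals -/

/-- Prime factors of a Darboux element of a derivation are Darboux elements. -/
theorem _root_.Derivation.dvd_apply_of_prime_of_dvd {k R : Type*} [CommRing k] [CommRing R]
    [IsDomain R] [WfDvdMonoid R] [Algebra k R] (X : Derivation k R R)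
    (hunit : ∀ n : ℕ, n ≠ 0 → IsUnit (n : R)) {F G : R}
    (hF : Prime F) (hG : G ≠ 0) (hFG : F ∣ G) (h : G ∣ X G) : F ∣ X F := by
  obtain ⟨n, H, hH, rfl⟩ := WfDvdMonoid.max_power_factor hG hF.irreducible
  have hn : n ≠ 0 := by
    rintro rfl
    exact hH (by simpa using hFG)
  obtain ⟨m, rfl⟩ := Nat.exists_eq_succ_of_ne_zero hn
  obtain ⟨L, hL⟩ := h
  rw [Derivation.leibniz, Derivation.leibniz_pow] at hL
  simp only [smul_eq_mul, nsmul_eq_mul, Nat.succ_eq_add_one, Nat.add_sub_cancel] at hL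
  -- Apply the product rule to `G = F^(m+1) H` and cancel `F^m`. As `F` divides neither `H` nor the
  -- unit `m + 1`, it divides `X F`.
  have hm : (((m + 1 : ℕ) : R) * H) * X F = F * (L * H - X H) := by
    refine mul_left_cancel₀ (pow_ne_zero m hF.ne_zero) ?_
    linear_combination hL
  rcases hF.dvd_or_dvd (Dvd.intro _ hm.symm) with h1 | h1
  · exact absurd (((hunit _ hn).dvd_mul_left).1 h1) hH
  · exact h1

theorem not_mem_range_C_of_irreducible {F : Poly2} (hF : Irreducible F) :
    F ∉ Set.range (MvPolynomial.C : ℂ → Poly2) := by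
  rintro ⟨c, rfl⟩
  rcases eq_or_ne c 0 with rfl | hc
  · exact hF.ne_zero (map_zero _)
  · exact hF.not_isUnit (hc.isUnit.map _)

/-- A rational first integral gives infinitely many irreducible invariant curves. -/
theorem infinite_irreducibleInvariantCurves {P Q : Poly2} {R : Rat2}
    (hR : IsRationalFirstIntegral P Q R) : (irreducibleInvariantCurves P Q).Infinite := by
  obtain ⟨hnc, h0⟩ := hR
  set A := IsFractionRing.num Poly2 R
  set B : Poly2 := (IsFractionRing.den Poly2 R : Poly2)
  have hB0 : B ≠ 0 := nonZeroDivisors.ne_zero (IsFractionRing.den Poly2 R).2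
  have hrel : IsRelPrime A B := IsFractionRing.num_den_reduced Poly2 R
  have hRAB : R = algebraMap Poly2 Rat2 A / algebraMap Poly2 Rat2 B := by
    rw [← IsFractionRing.mk'_eq_div, IsFractionRing.mk'_num_den]
  set X := vectorField P Q
  have hinj : Function.Injective (algebraMap Poly2 Rat2) := IsFractionRing.injective _ _
  have hBK : algebraMap Poly2 Rat2 B ≠ 0 := by rwa [Ne, map_eq_zero_iff _ hinj]
  have hW : X A * B - A * X B = 0 := by
    have h1 : algebraMap Poly2 Rat2 (X A * B - A * X B) / algebraMap Poly2 Rat2 B ^ 2 = 0 := h0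
    rw [div_eq_zero_iff, or_iff_left (pow_ne_zero 2 hBK), map_eq_zero_iff _ hinj] at h1
    exact h1
  have hA0 : A ≠ 0 := by
    intro h
    rw [h, map_zero, zero_div] at hRAB
    exact hnc ⟨0, by simp [hRAB]⟩
  -- From `X A * B = A * X B` and coprimality, `A` and `B` get the same cofactor `L`; hence so does
  -- each member `A - cB` of the pencil.
  obtain ⟨L, hL⟩ : A ∣ X A := hrel.dvd_of_dvd_mul_right ⟨X B, by linear_combination hW⟩
  have hLB : X B = B * L := by
    refine mul_left_cancel₀ hA0 ?_
    linear_combination -hW + B * hL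
  let G : ℂ → Poly2 := fun c => A - MvPolynomial.C c * B
  have hXG (c : ℂ) : X (G c) = G c * L := by
    have hC : X (MvPolynomial.C c) = 0 := by
      rw [vectorField_apply]; simp
    simp only [G, map_sub, Derivation.leibniz, smul_eq_mul, hL, hLB, hC]
    ring
  -- Two constant members of the pencil would make `A` and `B` constant, and with them `R`.
  have hsub : {c | G c ∈ Set.range (MvPolynomial.C : ℂ → Poly2)}.Subsingleton := by
    rintro c ⟨u, hu⟩ d ⟨v, hv⟩
    by_contra hcd
    have hdc : d - c ≠ 0 := sub_ne_zero.2 (Ne.symm hcd)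
    have hBc : B = MvPolynomial.C ((u - v) / (d - c)) := by
      have h1 : MvPolynomial.C (d - c) * B = MvPolynomial.C (u - v) := by
        rw [map_sub, map_sub, hu, hv]; ring
      rw [div_eq_inv_mul, map_mul, ← h1, ← mul_assoc, ← map_mul, inv_mul_cancel₀ hdc, map_one,
        one_mul]
    have hAc : A = MvPolynomial.C (u + c * ((u - v) / (d - c))) := by
      rw [map_add, map_mul, hu, ← hBc]; ring
    refine hnc ⟨(u + c * ((u - v) / (d - c))) / ((u - v) / (d - c)), ?_⟩
    have hne : (u - v) / (d - c) ≠ 0 := by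
      intro h
      rw [h, map_zero] at hBc
      exact hB0 hBc
    rw [hRAB, eq_div_iff hBK, hAc, hBc, ← map_mul, ← map_mul, div_mul_cancel₀ _ hne]
  have hinf : {c | G c ∈ Set.range (MvPolynomial.C : ℂ → Poly2)}ᶜ.Infinite :=
    hsub.finite.infinite_compl
  have hex (c : ℂ) : ∃ F : Poly2, c ∈ {c | G c ∈ Set.range (MvPolynomial.C : ℂ → Poly2)}ᶜ →
      Irreducible F ∧ F ∣ G c := by
    by_cases hc : G c ∈ Set.range (MvPolynomial.C : ℂ → Poly2)
    · exact ⟨0, fun h => absurd hc h⟩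
    · obtain ⟨F, hF⟩ := WfDvdMonoid.exists_irreducible_factor (a := G c)
        (fun hu => hc (by
          rw [MvPolynomial.isUnit_iff_eq_C_of_isReduced] at hu
          obtain ⟨r, -, hr⟩ := hu
          exact ⟨r, hr.symm⟩))
        (fun h => hc ⟨0, by rw [h, map_zero]⟩)
      exact ⟨F, fun _ => hF⟩
  choose F hF using hex
  refine Set.infinite_of_injOn_mapsTo (f := fun c => Associates.mk (F c)) ?_ ?_ hinf
  -- A common factor of two members of the pencil divides both `A` and `B`, which are coprime.
  · intro c hc d hd hcd
    by_contra hne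
    have hassoc := Associates.mk_eq_mk_iff_associated.1 hcd
    have h1 : F c ∣ G c := (hF c hc).2
    have h2 : F c ∣ G d := hassoc.dvd.trans (hF d hd).2
    have hu : IsUnit (MvPolynomial.C (d - c) : Poly2) :=
      (sub_ne_zero.2 (Ne.symm hne)).isUnit.map _
    have h3 : F c ∣ B := by
      have h4 : F c ∣ MvPolynomial.C (d - c) * B := by
        have := dvd_sub h1 h2
        have e : G c - G d = MvPolynomial.C (d - c) * B := by
          simp only [G, map_sub]; ring
        rwa [e] at this
      exact (hu.dvd_mul_left).1 h4
    have h5 : F c ∣ A := by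
      have := dvd_add h1 (h3.mul_left (MvPolynomial.C c))
      rwa [sub_add_cancel] at this
    exact (hF c hc).1.not_isUnit (hrel h5 h3)
  · intro c hc
    obtain ⟨hirr, hdvd⟩ := hF c hc
    refine ⟨F c, ⟨hirr, not_mem_range_C_of_irreducible hirr, ?_⟩, rfl⟩
    obtain ⟨M, hM⟩ := X.dvd_apply_of_prime_of_dvd
      (fun n hn => by
        have h := (Nat.cast_ne_zero (R := ℂ).2 hn).isUnit.map (MvPolynomial.C (σ := Fin 2))
        rwa [map_natCast] at h)
      hirr.prime (fun h => hc ⟨0, by rw [h, map_zero]⟩) hdvd ⟨L, hXG c⟩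
    exact ⟨M, by rw [hM, mul_comm]⟩

end PlanarVectorField

theorem theorem4 (P Q : PlanarVectorField.Poly2) (hP : P ≠ 0) (hPQ : IsRelPrime P Q)
    (hfin : (PlanarVectorField.puiseuxSolutions P Q).Finite) :
    (PlanarVectorField.irreducibleInvariantCurves P Q).Finite ∧
    (¬ ∃ R : PlanarVectorField.Rat2, PlanarVectorField.IsRationalFirstIntegral P Q R) ∧
    (PlanarVectorField.irreducibleInvariantCurvesInY P Q).encard ≤
      (PlanarVectorField.puiseuxSolutions P Q).encard :=

  ⟨PlanarVectorField.finite_irreducibleInvariantCurves hP hfin,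
    fun ⟨_, hR⟩ => PlanarVectorField.infinite_irreducibleInvariantCurves hR
      (PlanarVectorField.finite_irreducibleInvariantCurves hP hfin),
    PlanarVectorField.encard_irreducibleInvariantCurvesInY_le P Q⟩
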